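/- Let $\mathbb Z_+=\{1,2,\dots\}$. A sequence of non-negative reals $\mathbf w=\{w_n\}_{n\ge 1}$ is a Hausdorff log-moment sequence if there is a positive Borel measure $\mu$ concentrated on $[0,1]$ whose restriction to $(0,1]$ is a Radon measure and such that $w_n=\int_{[0,1]}t^{\log n}\,\mu(dt)$ for all $n\ge 1$ (with $0^0=1$). A function $f:[0,\infty)\to[0,\infty)$ is completely monotone if it is continuous on $[0,\infty)$, is $C^\infty$ on $(0,\infty)$, and satisfies $(-1)^kf^{(k)}(x)\ge 0$ for all $x>0$ and $k\ge 0$. We call $(\mathbf w,f)$ a Dirichlet pair (with $j=1$) if $\mathbf w=\{w_n\}_{n\ge1}$ is a Hausdorff log-moment sequence and $f:[0,\infty)\to[0,\infty)$ is a completely monotone function with $f(0)\le w_1$ and $$w_n=(w_1-f(0))\,\chi_{\{1\}}(n)+f(\log n),\qquad n\ge 1.$$ **Corollary.** Let $(\mathbf w,f)$ be a Dirichlet pair with $j=1$ such that $\mathbf w\in\ell^2(\mathbb Z_+)$ and $w_1=f(0)$. If there exists a real number $C>0$ such that $$x f(x)\le C e^{-x/2},\qquad x\in[0,\infty),$$ then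 the Helson matrix $M(\mathbf w)=(w_{mn})_{m,n\ge1}$ defines a bounded linear operator on $\ell^2(\mathbb Z_+)$ (over $\mathbb R$ or $\mathbb C$); that is, there is a bounded linear operator $T$ on $\ell^2(\mathbb Z_+)$ with $(Tx)_m=\sum_{n\ge1}w_{mn}x_n$ (a convergent series) for all $x\in\ell^2(\mathbb Z_+)$ and $m\ge1$. **Example.** Let $0<\alpha<e^{-1/2}$, $w_n=\alpha^{\log n}$ for $n\ge1$, and $f(x)=\alpha^x$ for $x\ge0$. Then $(\mathbf w,f)$ satisfies all the hypotheses of the corollary, for some $C>0$, and so the Helson matrix $(\alpha^{\log(mn)})_{m,n\ge1}$ defines a bounded linear operator on $\ell^2(\mathbb Z_+)$. -/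

import Mathlib

open MeasureTheory Set
open scoped ContDiff ENNReal

/-- `μ` is a representing measure of the sequence `(w n)`, `n ≥ j`: a positive Borel measure,
concentrated on `[0, 1]`, whose restriction to `(0, 1]` is a Radon measure (locally finite and
inner regular on the space `(0, 1]`), with `w n = ∫ t ^ (log n) dμ(t)` for all `n ≥ j`.
The moments are integrals of nonnegative functions with values in `[0, ∞]`, so that the equation
contains the finiteness of the integral. Here `0 ^ 0 = 1`, and `μ {0} = ∞` is allowed. -/
structure IsRepresentingMeasure (j : ℕ+) (w : ℕ+ → ℝ) (μ : Measure ℝ) : Prop where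
  concentrated : μ (Icc (0 : ℝ) 1)ᶜ = 0
  locallyFinite : IsLocallyFiniteMeasure (μ.comap ((↑) : Ioc (0 : ℝ) 1 → ℝ))
  innerRegular : (μ.comap ((↑) : Ioc (0 : ℝ) 1 → ℝ)).InnerRegular
  moment : ∀ n : ℕ+, j ≤ n →
    ENNReal.ofReal (w n) = ∫⁻ t in Icc (0 : ℝ) 1, ENNReal.ofReal (t ^ Real.log (n : ℝ)) ∂μ

/-- `(w n)`, `n ≥ j`, is a Hausdorff log-moment sequence: it consists of nonnegative reals and has
a representing measure. Values `w n` with `n < j` are irrelevant. -/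
def IsHausdorffLogMoment (j : ℕ+) (w : ℕ+ → ℝ) : Prop :=
  (∀ n : ℕ+, j ≤ n → 0 ≤ w n) ∧ ∃ μ : Measure ℝ, IsRepresentingMeasure j w μ

/-- `f : [a, ∞) → [0, ∞)` is completely monotone: continuous on `[a, ∞)`, smooth on `(a, ∞)`, and
`(-1) ^ k f⁽ᵏ⁾ ≥ 0` on `(a, ∞)` for every `k ≥ 0`. Values of `f` outside `[a, ∞)` are
irrelevant. -/
structure IsCompletelyMonotone (a : ℝ) (f : ℝ → ℝ) : Prop where
  nonneg : ∀ x ∈ Ici a, 0 ≤ f x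
  continuousOn : ContinuousOn f (Ici a)
  contDiffOn : ContDiffOn ℝ ∞ f (Ioi a)
  alternating : ∀ k : ℕ, ∀ x ∈ Ioi a, 0 ≤ (-1 : ℝ) ^ k * iteratedDeriv k f x

/-- `(w, f)` is a Dirichlet pair with starting index `j`: `w` is a Hausdorff log-moment sequence,
`f` is completely monotone on `[log j, ∞)`, and
* if `j = 1`, then `f 0 ≤ w 1` and `w n = (w 1 - f 0) χ_{1}(n) + f (log n)` for all `n ≥ 1`;
* if `j ≥ 2`, then `w n = f (log n)` for all `n ≥ j`. -/
structure IsDirichletPair (j : ℕ+) (w : ℕ+ → ℝ) (f : ℝ → ℝ) : Prop where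
  hausdorffLogMoment : IsHausdorffLogMoment j w
  completelyMonotone : IsCompletelyMonotone (Real.log (j : ℝ)) f
  eq_of_one : j = 1 → f 0 ≤ w 1 ∧
    ∀ n : ℕ+, w n = (w 1 - f 0) * indicator {1} 1 n + f (Real.log (n : ℝ))
  eq_of_two_le : 2 ≤ j → ∀ n : ℕ+, j ≤ n → w n = f (Real.log (n : ℝ))

/-- The Helson matrix `(w (m n))`, `m, n ≥ 1`. -/
def helsonMatrix (w : ℕ+ → ℝ) : Matrix ℕ+ ℕ+ ℝ :=
  Matrix.of fun m n => w (m * n)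

/-- The infinite matrix `A` defines a bounded linear operator on `ℓ²` over `𝕜` (`ℝ` or `ℂ`): some
bounded operator `T` on `ℓ²` satisfies `(T x) m = ∑ n, A m n * x n` for all `x` and `m`, the series
being convergent. -/
def DefinesBoundedOperator (𝕜 : Type*) [RCLike 𝕜] (A : Matrix ℕ+ ℕ+ ℝ) : Prop :=
  ∃ T : lp (fun _ : ℕ+ => 𝕜) 2 →L[𝕜] lp (fun _ : ℕ+ => 𝕜) 2,
    ∀ (x : lp (fun _ : ℕ+ => 𝕜) 2) (m : ℕ+), HasSum (fun n : ℕ+ => (A m n : 𝕜) * x n) (T x m)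

/-! This is a multiplicative form of Hilbert's inequality. At `x = log n` the decay hypothesis gives
`w n ≤ D / (√n (log n + 1))`; positivity and this bound are all that is needed. With `b n = log n +
1/2` the entries are at most `D / (√m √n (b m + b n))`, and the Schur test is applied with weight `1
/ (√n √(b n))`. Since `1/n` is at most twice the increment of `b`, the row sums are controlled by
`∫₀^∞ dt / ((a + t) √t) = π / √a` at `a = b m`, which `sum_inv_mul_shiftedLog_le` carries out by
telescoping arctangents. In the example the representing measure is the unit mass at `α`. -/

/-! ### The Schur test -/

open Finset in
/-- Finite form of the Schur test. -/
theorem schur_test_finite {ι : Type*} {A : ι → ι → ℝ} {p : ι → ℝ} {M : ℝ}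
    (hA : ∀ m n, 0 ≤ A m n) (hp : ∀ n, 0 < p n)
    (hrow : ∀ m (T : Finset ι), ∑ n ∈ T, A m n * p n ≤ M * p m)
    (hcol : ∀ n (S : Finset ι), ∑ m ∈ S, A m n * p m ≤ M * p n)
    (y : ι → ℝ) (S T : Finset ι) :
    ∑ m ∈ S, (∑ n ∈ T, A m n * y n) ^ 2 ≤ M ^ 2 * ∑ n ∈ T, y n ^ 2 := by
  -- An index is required because `ι` may be empty; the empty row sum then gives `0 ≤ M * p m`.
  have hM : ∀ m : ι, 0 ≤ M := fun m =>
    nonneg_of_mul_nonneg_left (by simpa using hrow m ∅) (hp m)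
  calc ∑ m ∈ S, (∑ n ∈ T, A m n * y n) ^ 2
      ≤ ∑ m ∈ S, M * p m * ∑ n ∈ T, A m n * (y n ^ 2 / p n) := by
        refine sum_le_sum fun m _ => ?_
        -- Cauchy–Schwarz, from the splitting `(A y)² = (A p) (A y² / p)`.
        refine (sum_sq_le_sum_mul_sum_of_sq_le_mul T (f := fun n => A m n * p n)
          (g := fun n => A m n * (y n ^ 2 / p n)) (fun n _ => mul_nonneg (hA m n) (hp n).le)
          (fun n _ => mul_nonneg (hA m n) (div_nonneg (sq_nonneg _) (hp n).le))
          (fun n _ => Eq.le ?_)).trans ?_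
        · have := (hp n).ne'
          field_simp
        · exact mul_le_mul_of_nonneg_right (hrow m T) (sum_nonneg fun n _ =>
            mul_nonneg (hA m n) (div_nonneg (sq_nonneg _) (hp n).le))
    _ = ∑ n ∈ T, M * (y n ^ 2 / p n) * ∑ m ∈ S, A m n * p m := by
        simp_rw [mul_sum]
        rw [sum_comm]
        exact sum_congr rfl fun n _ => sum_congr rfl fun m _ => by ring
    _ ≤ ∑ n ∈ T, M * (y n ^ 2 / p n) * (M * p n) := by
        refine sum_le_sum fun n _ => mul_le_mul_of_nonneg_left (hcol n S) ?_
        exact mul_nonneg (hM n) (div_nonneg (sq_nonneg _) (hp n).le)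
    _ = M ^ 2 * ∑ n ∈ T, y n ^ 2 := by
        rw [mul_sum]
        refine sum_congr rfl fun n _ => ?_
        have := (hp n).ne'
        field_simp

/-- The Schur test: a symmetric matrix with nonnegative entries and a positive weight `p` with
`A p ≤ M p` defines a bounded operator on `ℓ²`. -/
theorem definesBoundedOperator_of_schur (𝕜 : Type*) [RCLike 𝕜] {A : Matrix ℕ+ ℕ+ ℝ}
    {p : ℕ+ → ℝ} {M : ℝ} (hA : ∀ m n, 0 ≤ A m n) (hsymm : ∀ m n, A m n = A n m)
    (hp : ∀ n, 0 < p n) (hrow : ∀ m (T : Finset ℕ+), ∑ n ∈ T, A m n * p n ≤ M * p m) :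
    DefinesBoundedOperator 𝕜 A := by
  have hM : 0 ≤ M := nonneg_of_mul_nonneg_left (by simpa using hrow 1 ∅) (hp 1)
  have hcol : ∀ n (S : Finset ℕ+), ∑ m ∈ S, A m n * p m ≤ M * p n := fun n S => by
    simpa only [hsymm _ n] using hrow n S
  have hnorm : ∀ (x : lp (fun _ : ℕ+ => 𝕜) 2) (T : Finset ℕ+),
      ∑ n ∈ T, ‖x n‖ ^ 2 ≤ ‖x‖ ^ 2 := fun x T => by
    have := lp.sum_rpow_le_norm_rpow (p := 2) (by norm_num) x T
    simpa using this
  have hfin : ∀ (x : lp (fun _ : ℕ+ => 𝕜) 2) (S T : Finset ℕ+),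
      ∑ m ∈ S, (∑ n ∈ T, A m n * ‖x n‖) ^ 2 ≤ (M * ‖x‖) ^ 2 := fun x S T => by
    rw [mul_pow]
    exact (schur_test_finite hA hp hrow hcol (fun n => ‖x n‖) S T).trans
      (mul_le_mul_of_nonneg_left (hnorm x T) (sq_nonneg M))
  have hsumN : ∀ (x : lp (fun _ : ℕ+ => 𝕜) 2) (m : ℕ+),
      Summable fun n => A m n * ‖x n‖ := fun x m => by
    refine summable_of_sum_le (c := M * ‖x‖) (fun n => mul_nonneg (hA m n) (norm_nonneg _))
      fun T => ?_
    have := hfin x {m} T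
    rw [Finset.sum_singleton] at this
    exact le_of_sq_le_sq this (mul_nonneg hM (norm_nonneg _))
  have hnormterm : ∀ (x : lp (fun _ : ℕ+ => 𝕜) 2) (m n : ℕ+),
      ‖(A m n : 𝕜) * x n‖ = A m n * ‖x n‖ := fun x m n => by
    rw [norm_mul, RCLike.norm_ofReal, abs_of_nonneg (hA m n)]
  have hsum : ∀ (x : lp (fun _ : ℕ+ => 𝕜) 2) (m : ℕ+),
      Summable fun n => (A m n : 𝕜) * x n := fun x m =>
    Summable.of_norm (by simpa only [hnormterm] using hsumN x m)
  have hbound : ∀ (x : lp (fun _ : ℕ+ => 𝕜) 2) (S : Finset ℕ+),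
      ∑ m ∈ S, ‖∑' n, (A m n : 𝕜) * x n‖ ^ 2 ≤ (M * ‖x‖) ^ 2 := fun x S => by
    -- The bound in `hfin` is uniform in `T`, so it survives the limit with `S` fixed.
    have hlim : Filter.Tendsto
        (fun T : Finset ℕ+ => ∑ m ∈ S, (∑ n ∈ T, A m n * ‖x n‖) ^ 2) Filter.atTop
        (nhds (∑ m ∈ S, (∑' n, A m n * ‖x n‖) ^ 2)) :=
      tendsto_finsetSum _ fun m _ => ((hsumN x m).hasSum).pow 2
    refine le_trans (Finset.sum_le_sum fun m _ => ?_) (le_of_tendsto' hlim (hfin x S))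
    refine pow_le_pow_left₀ (norm_nonneg _) ?_ 2
    refine (norm_tsum_le_tsum_norm (by simpa only [hnormterm] using hsumN x m)).trans_eq ?_
    simp only [hnormterm]
  let L : lp (fun _ : ℕ+ => 𝕜) 2 →ₗ[𝕜] lp (fun _ : ℕ+ => 𝕜) 2 :=
    { toFun := fun x => ⟨fun m => ∑' n, (A m n : 𝕜) * x n,
        memℓp_gen' (C := (M * ‖x‖) ^ 2) fun S => by simpa using hbound x S⟩
      map_add' := fun x y => by
        ext m
        simp only [lp.coeFn_add, Pi.add_apply, mul_add]
        exact (hsum x m).tsum_add (hsum y m)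
      map_smul' := fun c x => by
        ext m
        simp only [lp.coeFn_smul, Pi.smul_apply, smul_eq_mul, RingHom.id_apply,
          mul_left_comm _ c]
        exact tsum_mul_left }
  refine ⟨L.mkContinuous M fun x => ?_, fun x m => (hsum x m).hasSum⟩
  refine lp.norm_le_of_forall_sum_le (p := 2) (by norm_num)
    (mul_nonneg hM (norm_nonneg _)) fun S => ?_
  simpa [L] using hbound x S

/-! ### Hilbert-type row sums over logarithms -/

/-- On `[x, y]` the derivative `1 / (1 + z²)` is smallest at the right endpoint. -/
theorem div_one_add_sq_le_arctan_sub {x y : ℝ} (hx : 0 ≤ x) (hxy : x ≤ y) :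
    (y - x) / (1 + y ^ 2) ≤ Real.arctan y - Real.arctan x := by
  have h := Convex.mul_sub_le_image_sub_of_le_deriv (convex_Icc x y)
    Real.continuous_arctan.continuousOn Real.differentiable_arctan.differentiableOn
    (C := 1 / (1 + y ^ 2)) (fun z hz => ?_) x (left_mem_Icc.2 hxy) y (right_mem_Icc.2 hxy) hxy
  · rwa [one_div_mul_eq_div] at h
  · rw [interior_Icc] at hz
    have hz0 : 0 ≤ z := hx.trans hz.1.le
    rw [Real.deriv_arctan]
    exact one_div_le_one_div_of_le (by positivity)
      (add_le_add_right (pow_le_pow_left₀ hz0 hz.2.le 2) 1)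

/-- Comparison of a term of `∑ 1 / ((a + v) √v)` with an increment of the antiderivative. -/
theorem sub_div_le_arctan_increment {a u v : ℝ} (ha : 0 < a) (hu : 0 ≤ u) (huv : u ≤ v)
    (hv : 0 < v) :
    (v - u) / ((a + v) * √v) ≤
      2 / √a * (Real.arctan (√v / √a) - Real.arctan (√u / √a)) := by
  have hsa : 0 < √a := Real.sqrt_pos.2 ha
  have hsv : 0 < √v := Real.sqrt_pos.2 hv
  have hsuv : √u ≤ √v := Real.sqrt_le_sqrt huv
  have h := div_one_add_sq_le_arctan_sub (x := √u / √a) (y := √v / √a) (by positivity)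
    (by gcongr)
  refine le_trans ?_ (mul_le_mul_of_nonneg_left h (by positivity))
  have e : 2 / √a * ((√v / √a - √u / √a) / (1 + (√v / √a) ^ 2)) =
      2 * (√v - √u) / (a + v) := by
    rw [div_pow, Real.sq_sqrt hv.le, Real.sq_sqrt ha.le]
    have : a + v ≠ 0 := by positivity
    field_simp
    rw [Real.sq_sqrt ha.le, mul_comm]
  rw [e, div_le_div_iff₀ (by positivity) (by positivity)]
  have hv2 := Real.sq_sqrt hv.le
  have hu2 := Real.sq_sqrt hu
  -- The difference of the two sides is `(√v - √u)²`.
  have : v - u ≤ 2 * (√v - √u) * √v := by nlinarith [sq_nonneg (√v - √u)]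
  nlinarith [mul_le_mul_of_nonneg_right this (by positivity : 0 ≤ a + v)]

/-- The sequence `log n + 1 / 2` for `n ≥ 1`, extended by `0` at `n = 0`. -/
noncomputable def shiftedLog (n : ℕ) : ℝ := if n = 0 then 0 else Real.log n + 1 / 2

theorem shiftedLog_nonneg (n : ℕ) : 0 ≤ shiftedLog n := by
  unfold shiftedLog
  split_ifs
  · exact le_rfl
  · have := Real.log_natCast_nonneg n
    positivity

theorem shiftedLog_of_pnat (n : ℕ+) : shiftedLog n = Real.log (n : ℝ) + 1 / 2 :=
  if_neg n.ne_zero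

theorem shiftedLog_pos (n : ℕ+) : 0 < shiftedLog n := by
  rw [shiftedLog_of_pnat]
  have := Real.log_natCast_nonneg (n : ℕ)
  positivity

/-- The factor 2 is forced by the jump from 0 to 1/2 at `k = 0`, where equality holds; for `k ≥ 1`,
`log (1 + 1/k) ≥ 1/(k + 1)` would do without it. -/
theorem inv_le_two_mul_shiftedLog_sub (k : ℕ) :
    ((k : ℝ) + 1)⁻¹ ≤ 2 * (shiftedLog (k + 1) - shiftedLog k) := by
  rcases Nat.eq_zero_or_pos k with rfl | hk
  · simp [shiftedLog]
  · have hk' : (0 : ℝ) < k := Nat.cast_pos.2 hk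
    rw [shiftedLog, shiftedLog, if_neg k.succ_ne_zero, if_neg hk.ne']
    have h := Real.log_le_sub_one_of_pos (x := (k : ℝ) / (k + 1)) (by positivity)
    rw [Real.log_div hk'.ne' (by positivity)] at h
    have e : (k : ℝ) / (k + 1) - 1 = -((k : ℝ) + 1)⁻¹ := by field_simp; ring
    have : 0 < ((k : ℝ) + 1)⁻¹ := by positivity
    push_cast
    linarith

theorem sum_inv_mul_shiftedLog_le {a : ℝ} (ha : 0 < a) (T : Finset ℕ+) :
    ∑ n ∈ T, 1 / ((n : ℝ) * ((a + shiftedLog n) * √(shiftedLog n))) ≤ 2 * Real.pi / √a := by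
  have hsa : 0 < √a := Real.sqrt_pos.2 ha
  set G : ℕ → ℝ := fun k => Real.arctan (√(shiftedLog k) / √a) with hG
  have hmono : ∀ k, shiftedLog k ≤ shiftedLog (k + 1) := fun k => by
    have := inv_le_two_mul_shiftedLog_sub k
    have : 0 < ((k : ℝ) + 1)⁻¹ := by positivity
    linarith
  have hGmono : ∀ k, 0 ≤ G (k + 1) - G k := fun k => by
    rw [sub_nonneg]
    refine Real.arctan_mono ?_
    have := Real.sqrt_le_sqrt (hmono k)
    gcongr
  calc ∑ n ∈ T, 1 / ((n : ℝ) * ((a + shiftedLog n) * √(shiftedLog n)))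
      ≤ ∑ n ∈ T, 4 / √a * (G (n.natPred + 1) - G n.natPred) := by
        refine Finset.sum_le_sum fun n _ => ?_
        have hn : n.natPred + 1 = (n : ℕ) := n.natPred_add_one
        have hpos := shiftedLog_pos n
        have h1 := inv_le_two_mul_shiftedLog_sub n.natPred
        have hm := hmono n.natPred
        rw [← Nat.cast_add_one, hn] at h1
        rw [hn] at hm
        have h2 := sub_div_le_arctan_increment ha (shiftedLog_nonneg n.natPred) hm hpos
        rw [hn]
        calc 1 / ((n : ℝ) * ((a + shiftedLog n) * √(shiftedLog n)))
            = ((n : ℕ) : ℝ)⁻¹ / ((a + shiftedLog n) * √(shiftedLog n)) := by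
              rw [one_div, mul_inv, div_eq_mul_inv]
          _ ≤ 2 * (shiftedLog n - shiftedLog n.natPred) /
                ((a + shiftedLog n) * √(shiftedLog n)) := by gcongr
          _ = 2 * ((shiftedLog n - shiftedLog n.natPred) /
                ((a + shiftedLog n) * √(shiftedLog n))) := mul_div_assoc _ _ _
          _ ≤ 2 * (2 / √a * (G n - G n.natPred)) := by gcongr
          _ = 4 / √a * (G n - G n.natPred) := by ring
    _ = 4 / √a * ∑ k ∈ T.map ⟨PNat.natPred, PNat.natPred_injective⟩, (G (k + 1) - G k) := by
        rw [← Finset.mul_sum, Finset.sum_map]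
        rfl
    _ ≤ 4 / √a * (Real.pi / 2) := by
        refine mul_le_mul_of_nonneg_left ?_ (by positivity)
        obtain ⟨N, hN⟩ := (T.map ⟨PNat.natPred, PNat.natPred_injective⟩).exists_nat_subset_range
        refine (Finset.sum_le_sum_of_subset_of_nonneg hN fun k _ _ => hGmono k).trans ?_
        rw [Finset.sum_range_sub]
        have h0 : G 0 = 0 := by simp [hG, shiftedLog]
        rw [h0, sub_zero]
        exact (Real.arctan_lt_pi_div_two _).le
    _ = 2 * Real.pi / √a := by ring

/-- A Helson matrix whose symbol is nonnegative and dominated by `1 / (√n (log n + 1))` is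
bounded. -/
theorem definesBoundedOperator_helsonMatrix_of_le (𝕜 : Type*) [RCLike 𝕜] {w : ℕ+ → ℝ} {D : ℝ}
    (hw : ∀ n, 0 ≤ w n)
    (hD : ∀ n : ℕ+, w n ≤ D * (1 / (√(n : ℝ) * (Real.log (n : ℝ) + 1)))) :
    DefinesBoundedOperator 𝕜 (helsonMatrix w) := by
  have hn0 : ∀ n : ℕ+, (0 : ℝ) < n := fun n => Nat.cast_pos.2 n.pos
  have hD0 : 0 ≤ D := by simpa using (hw 1).trans (hD 1)
  refine definesBoundedOperator_of_schur 𝕜 (p := fun n => 1 / (√(n : ℝ) * √(shiftedLog n)))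
    (M := D * (2 * Real.pi)) (fun m n => hw _)
    (fun m n => by simp [helsonMatrix, mul_comm]) (fun n => ?_) fun m T => ?_
  · have := hn0 n
    have := shiftedLog_pos n
    positivity
  · have hm := Real.sqrt_pos.2 (hn0 m)
    have hbm := Real.sqrt_pos.2 (shiftedLog_pos m)
    calc ∑ n ∈ T, helsonMatrix w m n * (1 / (√(n : ℝ) * √(shiftedLog n)))
        ≤ ∑ n ∈ T, D / √(m : ℝ) *
            (1 / ((n : ℝ) * ((shiftedLog m + shiftedLog n) * √(shiftedLog n)))) := by
          refine Finset.sum_le_sum fun n _ => ?_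
          have hn := Real.sqrt_pos.2 (hn0 n)
          have hbn := Real.sqrt_pos.2 (shiftedLog_pos n)
          have hs : 0 < shiftedLog m + shiftedLog n := add_pos (shiftedLog_pos m) (shiftedLog_pos n)
          have h := hD (m * n)
          -- The shift by 1/2 splits the 1 evenly between `m` and `n`.
          have e : Real.log ((m * n : ℕ+) : ℝ) + 1 = shiftedLog m + shiftedLog n := by
            rw [shiftedLog_of_pnat, shiftedLog_of_pnat, PNat.mul_coe, Nat.cast_mul,
              Real.log_mul (hn0 m).ne' (hn0 n).ne']
            ring
          rw [e, PNat.mul_coe, Nat.cast_mul, Real.sqrt_mul (hn0 m).le] at h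
          refine (mul_le_mul_of_nonneg_right h (by positivity)).trans_eq ?_
          have hsq : (n : ℝ) = √(n : ℝ) * √(n : ℝ) := (Real.mul_self_sqrt (hn0 n).le).symm
          rw [show (1 : ℝ) / ((n : ℝ) * ((shiftedLog m + shiftedLog n) * √(shiftedLog n))) =
            1 / (√(n : ℝ) * √(n : ℝ) * ((shiftedLog m + shiftedLog n) * √(shiftedLog n))) by
              rw [← hsq]]
          field_simp
      _ ≤ D / √(m : ℝ) * (2 * Real.pi / √(shiftedLog m)) := by
          rw [← Finset.mul_sum]
          exact mul_le_mul_of_nonneg_left (sum_inv_mul_shiftedLog_le (shiftedLog_pos m) T)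
            (by positivity)
      _ = D * (2 * Real.pi) * (1 / (√(m : ℝ) * √(shiftedLog m))) := by
          field_simp

/-! ### Dirichlet pairs -/

theorem exp_neg_log_natCast_div_two {n : ℕ} (hn : 0 < n) :
    Real.exp (-Real.log n / 2) = 1 / √(n : ℝ) := by
  have hn' : (0 : ℝ) < n := Nat.cast_pos.2 hn
  rw [neg_div, Real.exp_neg, one_div, ← Real.log_sqrt hn'.le, Real.exp_log (Real.sqrt_pos.2 hn')]

theorem IsDirichletPair.definesBoundedOperator (𝕜 : Type*) [RCLike 𝕜] {w : ℕ+ → ℝ} {f : ℝ → ℝ}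
    (h : IsDirichletPair 1 w f) (hwf : w 1 = f 0) {C : ℝ} (hC0 : 0 < C)
    (hC : ∀ x : ℝ, 0 ≤ x → x * f x ≤ C * Real.exp (-x / 2)) :
    DefinesBoundedOperator 𝕜 (helsonMatrix w) := by
  have hf : ∀ n : ℕ+, w n = f (Real.log (n : ℝ)) := fun n => by
    rw [(h.eq_of_one rfl).2 n, hwf, sub_self, zero_mul, zero_add]
  have hw : ∀ n, 0 ≤ w n := fun n => h.hausdorffLogMoment.1 n one_le
  have hlog2 : 0 < Real.log 2 := Real.log_pos one_lt_two
  -- The hypothesis says nothing about `f 0`, so `w 1` covers `n = 1`. For `n ≥ 2`, the bounds on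
  -- `log n * w n` and on `w n` (as `log n ≥ log 2`) add up to the other term.
  refine definesBoundedOperator_helsonMatrix_of_le 𝕜 (D := w 1 + C * (1 + 1 / Real.log 2)) hw
    fun n => ?_
  have hK : 0 < C * (1 + 1 / Real.log 2) := by positivity
  rcases eq_or_ne n 1 with rfl | hn
  · simpa using hK.le
  · have hn2 : (2 : ℝ) ≤ n := by
      have h1 : (1 : ℕ) < n := by
        rw [← PNat.one_coe, PNat.coe_lt_coe]
        exact lt_of_le_of_ne one_le hn.symm
      exact_mod_cast h1
    have hx : Real.log 2 ≤ Real.log (n : ℝ) := Real.log_le_log two_pos hn2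
    have hx0 : 0 < Real.log (n : ℝ) := hlog2.trans_le hx
    have hs : 0 < √(n : ℝ) := Real.sqrt_pos.2 (by linarith)
    have hb := hC _ hx0.le
    rw [← hf, exp_neg_log_natCast_div_two n.pos] at hb
    have hwn : w n ≤ C * (1 / √(n : ℝ)) / Real.log 2 := by
      rw [le_div_iff₀ hlog2, mul_comm]
      exact (mul_le_mul_of_nonneg_right hx (hw n)).trans hb
    have hsum : (Real.log (n : ℝ) + 1) * w n ≤ C * (1 + 1 / Real.log 2) * (1 / √(n : ℝ)) :=
      calc (Real.log (n : ℝ) + 1) * w n = Real.log (n : ℝ) * w n + w n := by ring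
        _ ≤ C * (1 / √(n : ℝ)) + C * (1 / √(n : ℝ)) / Real.log 2 := add_le_add hb hwn
        _ = C * (1 + 1 / Real.log 2) * (1 / √(n : ℝ)) := by ring
    calc w n ≤ C * (1 + 1 / Real.log 2) * (1 / √(n : ℝ)) / (Real.log (n : ℝ) + 1) := by
          rw [le_div_iff₀ (by positivity), mul_comm]
          exact hsum
      _ = C * (1 + 1 / Real.log 2) * (1 / (√(n : ℝ) * (Real.log (n : ℝ) + 1))) := by
          field_simp
      _ ≤ _ := by
          gcongr
          linarith [hw 1]

/-! ### The example -/

theorem isRepresentingMeasure_dirac {α : ℝ} (h0 : 0 < α) (h1 : α ≤ 1) :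
    IsRepresentingMeasure 1 (fun n : ℕ+ => α ^ Real.log (n : ℝ)) (Measure.dirac α) := by
  have hcomap : (Measure.dirac α).comap ((↑) : Ioc (0 : ℝ) 1 → ℝ) =
      Measure.dirac (⟨α, h0, h1⟩ : Ioc (0 : ℝ) 1) := by
    ext s hs
    rw [(MeasurableEmbedding.subtype_coe measurableSet_Ioc).comap_apply,
      Measure.dirac_apply' _ ((MeasurableEmbedding.subtype_coe
        measurableSet_Ioc).measurableSet_image.2 hs), Measure.dirac_apply' _ hs]
    by_cases hm : (⟨α, h0, h1⟩ : Ioc (0 : ℝ) 1) ∈ s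
    · rw [indicator_of_mem hm, indicator_of_mem (mem_image_of_mem _ hm)]
      rfl
    · rw [indicator_of_notMem hm, indicator_of_notMem]
      rintro ⟨y, hy, rfl⟩
      exact hm hy
  refine ⟨?_, ?_, ?_, fun n _ => ?_⟩
  · rw [Measure.dirac_apply' _ measurableSet_Icc.compl, indicator_of_notMem]
    exact fun h => h ⟨h0.le, h1⟩
  · rw [hcomap]
    infer_instance
  · rw [hcomap]
    refine ⟨fun U hU r hr => ?_⟩
    rw [Measure.dirac_apply' _ hU] at hr
    have hmem : (⟨α, h0, h1⟩ : Ioc (0 : ℝ) 1) ∈ U := by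
      by_contra hm
      rw [indicator_of_notMem hm] at hr
      exact not_lt_bot hr
    refine ⟨{⟨α, h0, h1⟩}, singleton_subset_iff.2 hmem, isCompact_singleton, ?_⟩
    rw [indicator_of_mem hmem] at hr
    rwa [Measure.dirac_apply_of_mem (mem_singleton _)]
  · rw [Measure.restrict_eq_self_of_ae_mem, lintegral_dirac]
    exact (ae_dirac_iff measurableSet_Icc).2 ⟨h0.le, h1⟩

theorem isCompletelyMonotone_rpow {α : ℝ} (h0 : 0 < α) (h1 : α ≤ 1) (a : ℝ) :
    IsCompletelyMonotone a fun x : ℝ => α ^ x := by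
  have e : (fun x : ℝ => α ^ x) = fun x => Real.exp (Real.log α * x) :=
    funext fun x => Real.rpow_def_of_pos h0 x
  have hsmooth : ContDiff ℝ ∞ fun x : ℝ => α ^ x := by
    rw [e]
    fun_prop
  refine ⟨fun x _ => (Real.rpow_pos_of_pos h0 x).le, hsmooth.continuous.continuousOn,
    hsmooth.contDiffOn, fun k x _ => ?_⟩
  rw [e, iteratedDeriv_exp_const_mul, ← mul_assoc, ← mul_pow, neg_one_mul]
  have := Real.log_nonpos h0.le h1
  exact mul_nonneg (pow_nonneg (by linarith) k) (Real.exp_pos _).le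

theorem isDirichletPair_rpow {α : ℝ} (h0 : 0 < α) (h1 : α ≤ 1) :
    IsDirichletPair 1 (fun n : ℕ+ => α ^ Real.log (n : ℝ)) (fun x : ℝ => α ^ x) where
  hausdorffLogMoment := ⟨fun n _ => (Real.rpow_pos_of_pos h0 _).le, _,
    isRepresentingMeasure_dirac h0 h1⟩
  completelyMonotone := isCompletelyMonotone_rpow h0 h1 _
  eq_of_one _ := by simp
  eq_of_two_le h := absurd h (by decide)

/-- Since `α ^ log n = n ^ log α`, the squares form a `p`-series with exponent `2 log α < -1`. -/
theorem memℓp_rpow_log {α : ℝ} (h0 : 0 < α) (h1 : Real.log α < -1 / 2) :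
    Memℓp (fun n : ℕ+ => α ^ Real.log (n : ℝ)) 2 := by
  refine memℓp_gen ?_
  have hs : Summable fun n : ℕ => (n : ℝ) ^ (Real.log α * 2) :=
    Real.summable_nat_rpow.2 (by linarith)
  refine (hs.comp_injective PNat.coe_injective).congr fun n => ?_
  have hn : (0 : ℝ) < n := Nat.cast_pos.2 n.pos
  have e : α ^ Real.log (n : ℝ) = (n : ℝ) ^ Real.log α := by
    rw [Real.rpow_def_of_pos h0, Real.rpow_def_of_pos hn, mul_comm]
  rw [e, Real.norm_of_nonneg (by positivity), Function.comp_apply, ENNReal.toReal_ofNat,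
    ← Real.rpow_mul hn.le]

/-- With `δ = -1/2 - log α > 0`, the inequality `δ x ≤ exp (δ x)` gives `C = 1/δ`. -/
theorem mul_rpow_le_exp {α : ℝ} (h0 : 0 < α) (h1 : Real.log α < -1 / 2) :
    ∃ C : ℝ, 0 < C ∧ ∀ x : ℝ, 0 ≤ x → x * α ^ x ≤ C * Real.exp (-x / 2) := by
  have hδ : 0 < -1 / 2 - Real.log α := sub_pos.2 h1
  refine ⟨1 / (-1 / 2 - Real.log α), by positivity, fun x _ => ?_⟩
  have hx : (-1 / 2 - Real.log α) * x ≤ Real.exp ((-1 / 2 - Real.log α) * x) := by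
    linarith [Real.add_one_le_exp ((-1 / 2 - Real.log α) * x)]
  rw [Real.rpow_def_of_pos h0, one_div_mul_eq_div, le_div_iff₀ hδ]
  calc x * Real.exp (Real.log α * x) * (-1 / 2 - Real.log α)
      = (-1 / 2 - Real.log α) * x * Real.exp (Real.log α * x) := by ring
    _ ≤ Real.exp ((-1 / 2 - Real.log α) * x) * Real.exp (Real.log α * x) := by gcongr
    _ = Real.exp (-x / 2) := by
        rw [← Real.exp_add]
        ring_nf

theorem mainTheorem10 (𝕜 : Type*) [RCLike 𝕜] :
    (∀ (w : ℕ+ → ℝ) (f : ℝ → ℝ), IsDirichletPair 1 w f → Memℓp w 2 → w 1 = f 0 →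
      (∃ C : ℝ, 0 < C ∧ ∀ x : ℝ, 0 ≤ x → x * f x ≤ C * Real.exp (-x / 2)) →
      DefinesBoundedOperator 𝕜 (helsonMatrix w)) ∧
    (∀ α : ℝ, 0 < α → α < Real.exp (-1 / 2) →
      (IsDirichletPair 1 (fun n : ℕ+ => α ^ Real.log (n : ℝ)) (fun x : ℝ => α ^ x) ∧
        Memℓp (fun n : ℕ+ => α ^ Real.log (n : ℝ)) 2 ∧
        α ^ Real.log ((1 : ℕ+) : ℝ) = α ^ (0 : ℝ) ∧
        ∃ C : ℝ, 0 < C ∧ ∀ x : ℝ, 0 ≤ x → x * α ^ x ≤ C * Real.exp (-x / 2)) ∧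
      DefinesBoundedOperator 𝕜
        (Matrix.of fun m n : ℕ+ => α ^ Real.log ((m : ℝ) * (n : ℝ)))) := by
  refine ⟨fun w f h _ hwf ⟨C, hC0, hC⟩ => h.definesBoundedOperator 𝕜 hwf hC0 hC,
    fun α h0 h1 => ?_⟩
  have hlog : Real.log α < -1 / 2 := (Real.log_lt_iff_lt_exp h0).2 h1
  have hα1 : α ≤ 1 := h1.le.trans (Real.exp_le_one_iff.2 (by norm_num))
  have hpair := isDirichletPair_rpow h0 hα1
  have hw1 : α ^ Real.log ((1 : ℕ+) : ℝ) = α ^ (0 : ℝ) := by simp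
  have hbd := mul_rpow_le_exp h0 hlog
  refine ⟨⟨hpair, memℓp_rpow_log h0 hlog, hw1, hbd⟩, ?_⟩
  obtain ⟨C, hC0, hC⟩ := hbd
  have e : (Matrix.of fun m n : ℕ+ => α ^ Real.log ((m : ℝ) * (n : ℝ))) =
      helsonMatrix fun n : ℕ+ => α ^ Real.log (n : ℝ) := by
    ext m n
    simp [helsonMatrix]
  rw [e]
  exact hpair.definesBoundedOperator 𝕜 hw1 hC0 hC
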